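/- **Rudimentary functions** (from tuples of sets to sets) are generated as follows: the functions $F(x_1,\dots,x_n)=x_i$, $F(x_1,\dots,x_n)=\{x_i,x_j\}$ and $F(x_1,\dots,x_n)=x_i\setminus x_j$ are rudimentary, and if $G,H,H_1,\dots,H_k$ are rudimentary then so are $F(x_1,\dots,x_n)=G(H_1(x_1,\dots,x_n),\dots,H_k(x_1,\dots,x_n))$ and $F(x_1,\dots,x_n)=\bigcup_{y\in x_1}H(y,x_2,\dots,x_n)$. The **rudimentary closure** of a set $x$ is the smallest set $y$ such that $x\subseteq y$, $x\in y$, and $y$ is closed under all rudimentary functions. Let $J_1$ be the rudimentary closure of $J_0=\emptyset$, and $J_2$ the rudimentary closure of $J_1$. An **$\iota$-set** is an element of $J_2$. An **$\iota$-class** is a subset $X$ of $J_2$ that is definable over $J_2$ by a first-order formula in the symbols $\in,\subseteq,=$ with quantifiers ranging over $J_2$ and parameters from $J_2$, and such that $X\cap x$ is an $\iota$-set for every $\iota$-set $x$. An **$\iota$-function** from an $\iota$-class $X$ to an $\iota$-class $Y$ is a function $F:X\to Y$ whose graph $\{\langle a,F(a)\rangle : a\in X\}$ (with $\langle a,b\rangle=\{\{a\},\{a,b\}\}$)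 is an $\iota$-class and such that for every $\iota$-set $x\subseteq X$ the image $F[x]$ is contained in an $\iota$-set. An **$\iota$-bijection** from $X$ to $Y$ is a bijection $F:X\to Y$ such that both $F$ and $F^{-1}$ are $\iota$-functions. Natural numbers are the von Neumann ones, $0=\emptyset$, $n+1=\{0,\dots,n\}$, and $\mathbf N=\{0,1,2,\dots\}$. **Theorem 2.10.** Let $x$ be an $\iota$-set. If $x$ is infinite, then there is an $\iota$-bijection from $\mathbf N$ onto $x$. If $x$ is finite, then there is an $\iota$-bijection from some natural number $n\in\mathbf N$ onto $x$. (So $J_2$ internally sees every set as countable.) -/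

import Mathlib

universe u

/-- Rudimentary functions of `n` variables, from tuples of sets to sets. -/
inductive IsRudimentary : (n : ℕ) → ((Fin n → ZFSet.{u}) → ZFSet.{u}) → Prop
  | proj {n : ℕ} (i : Fin n) : IsRudimentary n (fun v => v i)
  | pair {n : ℕ} (i j : Fin n) : IsRudimentary n (fun v => {v i, v j})
  | diff {n : ℕ} (i j : Fin n) : IsRudimentary n (fun v => v i \ v j)
  | comp {n k : ℕ} {G : (Fin k → ZFSet.{u}) → ZFSet.{u}}
      {H : Fin k → (Fin n → ZFSet.{u}) → ZFSet.{u}} :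
      IsRudimentary k G → (∀ i, IsRudimentary n (H i)) →
      IsRudimentary n (fun v => G (fun i => H i v))
  | union {n : ℕ} {H : (Fin (n + 1) → ZFSet.{u}) → ZFSet.{u}} :
      IsRudimentary (n + 1) H →
      IsRudimentary (n + 1)
        (fun v => ZFSet.iUnion (fun y : v 0 => H (Fin.cons y.1 (Fin.tail v))))

/-- `y` is closed under application of all rudimentary functions. -/
def RudClosed (y : ZFSet.{u}) : Prop :=
  ∀ (n : ℕ) (F : (Fin n → ZFSet.{u}) → ZFSet.{u}), IsRudimentary n F →
    ∀ v : Fin n → ZFSet.{u}, (∀ i, v i ∈ y) → F v ∈ y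

/-- `y` is the smallest set that includes `x`, has `x` as an element, and is closed under
application of all rudimentary functions. -/
def IsRudClosure (x y : ZFSet.{u}) : Prop :=
  (x ⊆ y ∧ x ∈ y ∧ RudClosed y) ∧ ∀ z : ZFSet.{u}, x ⊆ z → x ∈ z → RudClosed z → y ⊆ z

/-- A rudimentary function raises rank by at most a fixed finite amount. -/
theorem IsRudimentary.rank_le {n : ℕ} {F : (Fin n → ZFSet.{u}) → ZFSet.{u}}
    (hF : IsRudimentary n F) :
    ∃ k : ℕ, ∀ (a : Ordinal.{u}) (v : Fin n → ZFSet.{u}),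
      (∀ i, (v i).rank ≤ a) → (F v).rank ≤ a + k := by
  induction hF with
  | proj i => exact ⟨0, fun a v hv => by simpa using hv i⟩
  | pair i j =>
    refine ⟨1, fun a v hv => ?_⟩
    rw [ZFSet.rank_pair]
    have := hv i
    have := hv j
    simp [*]
  | diff i j =>
    refine ⟨0, fun a v hv => ?_⟩
    have : v i \ v j ⊆ v i := fun z hz => (ZFSet.mem_sdiff.1 hz).1
    simpa using (ZFSet.rank_mono this).trans (hv i)
  | comp hG hH ihG ihH =>
    obtain ⟨k, hk⟩ := ihG
    choose m hm using ihH
    refine ⟨Finset.univ.sup m + k, fun a v hv => ?_⟩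
    rw [Nat.cast_add, ← add_assoc]
    refine hk _ _ fun i => (hm i a v hv).trans ?_
    gcongr
    exact Finset.le_sup (Finset.mem_univ i)
  | union hH ih =>
    obtain ⟨k, hk⟩ := ih
    refine ⟨k, fun a v hv => ?_⟩
    rw [ZFSet.rank_le_iff]
    intro z hz
    obtain ⟨y, hy⟩ := ZFSet.mem_iUnion.1 hz
    refine (ZFSet.rank_lt_of_mem hy).trans_le (hk a _ fun i => ?_)
    refine Fin.cases ?_ (fun j => ?_) i
    · exact (ZFSet.rank_lt_of_mem y.2).le.trans (hv 0)
    · exact hv j.succ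

theorem exists_rudClosure (x : ZFSet.{u}) : ∃ y, IsRudClosure x y := by
  let V : ZFSet.{u} := ZFSet.vonNeumann (x.rank + Ordinal.omega0)
  have hxV : x.rank < x.rank + Ordinal.omega0 := by
    simp
  have hVx : x ⊆ V := fun z hz =>
    ZFSet.mem_vonNeumann.2 ((ZFSet.rank_lt_of_mem hz).trans hxV)
  have hxm : x ∈ V := ZFSet.mem_vonNeumann.2 hxV
  have hV : RudClosed V := by
    intro n F hF v hv
    obtain ⟨k, hk⟩ := hF.rank_le
    have h1 : ∀ i, ∃ m : ℕ, (v i).rank ≤ x.rank + m := by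
      intro i
      have h := ZFSet.mem_vonNeumann.1 (hv i)
      rw [Ordinal.lt_add_iff (by simp)] at h
      obtain ⟨d, hd, h⟩ := h
      obtain ⟨m, rfl⟩ := Ordinal.lt_omega0.1 hd
      exact ⟨m, h⟩
    choose m hm using h1
    refine ZFSet.mem_vonNeumann.2
      ((hk (x.rank + (Finset.univ.sup m : ℕ)) v fun i => (hm i).trans ?_).trans_lt ?_)
    · gcongr
      exact Finset.le_sup (Finset.mem_univ i)
    · rw [add_assoc, ← Nat.cast_add]
      gcongr
      exact Ordinal.natCast_lt_omega0 _
  refine ⟨V.sep (fun t => ∀ z : ZFSet.{u}, x ⊆ z → x ∈ z → RudClosed z → t ∈ z),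
    ⟨fun t ht => ?_, ?_, ?_⟩, ?_⟩
  · exact ZFSet.mem_sep.2 ⟨hVx ht, fun z hz _ _ => hz ht⟩
  · exact ZFSet.mem_sep.2 ⟨hxm, fun z _ hz _ => hz⟩
  · intro n F hF v hv
    refine ZFSet.mem_sep.2 ⟨hV n F hF v fun i => (ZFSet.mem_sep.1 (hv i)).1, ?_⟩
    intro z h1 h2 h3
    exact h3 n F hF v fun i => (ZFSet.mem_sep.1 (hv i)).2 z h1 h2 h3
  · intro z h1 h2 h3 t ht
    exact (ZFSet.mem_sep.1 ht).2 z h1 h2 h3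

/-- The rudimentary closure of a set. -/
noncomputable def rudClosure (x : ZFSet.{u}) : ZFSet.{u} :=
  Classical.choose (exists_rudClosure x)

theorem rudClosure_spec (x : ZFSet.{u}) : IsRudClosure x (rudClosure x) :=
  Classical.choose_spec (exists_rudClosure x)

/-- `J₁`, the rudimentary closure of `J₀ = ∅`. -/
noncomputable def J1 : ZFSet.{u} := rudClosure ∅

/-- `J₂`, the rudimentary closure of `J₁`. -/
noncomputable def J2 : ZFSet.{u} := rudClosure J1

/-- The two relation symbols of the language of set theory, for `∈` and `⊆`
(equality is a logical symbol). -/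
inductive SetLangRel : ℕ → Type
  | mem : SetLangRel 2
  | sub : SetLangRel 2

/-- The first-order language of set theory. -/
def setLang : FirstOrder.Language.{0, 0} := ⟨fun _ => Empty, SetLangRel⟩

/-- A set `x` as a universe of discourse: variables range over the elements of `x`, and `∈`, `⊆`
have their true meaning. -/
instance setStructure (x : ZFSet.{u}) : setLang.Structure x where
  funMap := fun f _ => Empty.elim f
  RelMap := fun r => match r with
    | SetLangRel.mem => fun v => (v 0).1 ∈ (v 1).1
    | SetLangRel.sub => fun v => (v 0).1 ⊆ (v 1).1

/-- `y` is a definable subset of `x`: it is cut out from `x` by a formula of the language of set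
theory relativized to `x`, with parameters from `x`. -/
def IsDefinableSubset (y x : ZFSet.{u}) : Prop :=
  y ⊆ x ∧ (Set.univ : Set x).Definable₁ setLang {a : x | a.1 ∈ y}

/-- An `ι`-set is an element of `J₂`. -/
def IsIotaSet (x : ZFSet.{u}) : Prop := x ∈ J2

/-- An `ι`-class is a definable subset of `J₂` whose intersection with every `ι`-set is an
`ι`-set. (Every subset of the set `J₂` is a set, so classes are represented as sets.) -/
def IsIotaClass (X : ZFSet.{u}) : Prop :=
  IsDefinableSubset X J2 ∧ ∀ x : ZFSet.{u}, IsIotaSet x → IsIotaSet (X ∩ x)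

/-- The graph of a function, as a set of Kuratowski pairs. -/
def funGraph {X Y : ZFSet.{u}} (F : X → Y) : ZFSet.{u} :=
  (X.prod Y).sep (fun p => ∃ a : X, p = ZFSet.pair a.1 (F a).1)

/-- `ι`-functions between `ι`-classes. -/
def IsIotaFun {X Y : ZFSet.{u}} (F : X → Y) : Prop :=
  IsIotaClass X ∧ IsIotaClass Y ∧ IsIotaClass (funGraph F) ∧
    ∀ x : ZFSet.{u}, IsIotaSet x → x ⊆ X →
      ∃ y : ZFSet.{u}, IsIotaSet y ∧ ∀ a : X, a.1 ∈ x → (F a).1 ∈ y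

/-- An `ι`-bijection is a bijection which is an `ι`-function in both directions. -/
def IsIotaBijection {X Y : ZFSet.{u}} (F : X ≃ Y) : Prop :=
  IsIotaFun (F : X → Y) ∧ IsIotaFun (F.symm : Y → X)

/-! Rudimentary functions include pairing, products, projections from pairs, and separation by any
relation built from rudimentary terms with connectives and bounded quantifiers. Hence a set cut out
by such a relation from elements of $J_2$, with parameters in $J_2$, is again in $J_2$. The proof
only has to exhibit the right sets.

First, $J_1=V_\omega$ (`J1_eq_vonNeumann`). Ackermann's coding, $c(x)=\sum_{y\in x}2^{c(y)}$, orders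
it so that each element has finitely many predecessors. This order is itself an element of $J_2$
(`exists_ackermann_order`): it is defined by recursion, and the recursion on any transitive element
of $V_\omega$ is witnessed by an element of $V_\omega$, so a quantifier bounded by $J_1$ suffices.

Second, every $x\in J_2$ belongs to a transitive subset of $J_2$ onto which some $f\in J_2$ maps a
subset of $J_1$ (`exists_covered_of_mem_J2`). The proof is by induction on the generation of
rudimentary functions. Choosing the preimage of least code for each element of $x$ puts $x$ in
correspondence with some $A\subseteq J_1$ (`exists_transversal`).

If $x$ is infinite, so is $A$. Send $a\in A$ to the number of its predecessors in $A$; this number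
is recognised by a bijection in $V_\omega$, so the enumeration of $A$ lies in $J_2$
(`exists_enumeration`). Composing gives the required graph. If $x$ is finite, any bijection has a
finite graph, and finite subsets of $J_2$ are elements of $J_2$. Graphs in $J_2$ between elements of
$J_2$ give $\iota$-functions because $J_2$ is transitive and closed under intersection. -/

open ZFSet

/-! ### Calculus of rudimentary functions and relations -/

/-- The union of the sets `h y` over the elements `y` of `x`. -/
noncomputable def biUnion (x : ZFSet.{u}) (h : ZFSet.{u} → ZFSet.{u}) : ZFSet.{u} :=
  ZFSet.iUnion (fun y : x => h y.1)

theorem mem_biUnion {x z : ZFSet.{u}} {h : ZFSet.{u} → ZFSet.{u}} :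
    z ∈ biUnion x h ↔ ∃ y ∈ x, z ∈ h y := by
  simp [biUnion, ZFSet.mem_iUnion]

/-- The first component of a Kuratowski pair. -/
noncomputable def fstSet (p : ZFSet.{u}) : ZFSet.{u} :=
  biUnion (⋃₀ p) fun a => biUnion ((⋃₀ p : ZFSet).sep fun b => p = pair a b) fun _ => a

/-- The second component of a Kuratowski pair. -/
noncomputable def sndSet (p : ZFSet.{u}) : ZFSet.{u} :=
  biUnion (⋃₀ p) fun a => biUnion ((⋃₀ p : ZFSet).sep fun b => p = pair a b) fun b => b

theorem left_mem_sUnion_pair (a b : ZFSet.{u}) : a ∈ (⋃₀ (pair a b) : ZFSet) := by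
  simp [pair]

theorem right_mem_sUnion_pair (a b : ZFSet.{u}) : b ∈ (⋃₀ (pair a b) : ZFSet) := by
  simp [pair]

@[simp] theorem fstSet_pair (a b : ZFSet.{u}) : fstSet (pair a b) = a := by
  ext z
  simp only [fstSet, mem_biUnion, mem_sep]
  constructor
  · rintro ⟨c, -, d, ⟨-, h⟩, hz⟩
    rwa [(pair_inj.1 h).1]
  · exact fun hz => ⟨a, left_mem_sUnion_pair a b, b, ⟨right_mem_sUnion_pair a b, rfl⟩, hz⟩

@[simp] theorem sndSet_pair (a b : ZFSet.{u}) : sndSet (pair a b) = b := by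
  ext z
  simp only [sndSet, mem_biUnion, mem_sep]
  constructor
  · rintro ⟨c, -, d, ⟨-, h⟩, hz⟩
    rwa [(pair_inj.1 h).2]
  · exact fun hz => ⟨a, left_mem_sUnion_pair a b, b, ⟨right_mem_sUnion_pair a b, rfl⟩, hz⟩

/-- A relation is rudimentary if it is the non-vacuity of a rudimentary function. -/
def RudRel (n : ℕ) (P : (Fin n → ZFSet.{u}) → Prop) : Prop :=
  ∃ F : (Fin n → ZFSet.{u}) → ZFSet.{u}, IsRudimentary n F ∧ ∀ v, P v ↔ ∃ z, z ∈ F v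

namespace IsRudimentary

variable {n : ℕ} {f g : (Fin n → ZFSet.{u}) → ZFSet.{u}}

/-- In a composition, positive arity of the outer function supplies an inner function, whose arity
is that of the composite. `Covered.image` needs this to code argument tuples, which must be
nonempty. -/
theorem pos {n : ℕ} {F : (Fin n → ZFSet.{u}) → ZFSet.{u}} (hF : IsRudimentary n F) : 0 < n := by
  induction hF with
  | proj i => exact i.pos
  | pair i j => exact i.pos
  | diff i j => exact i.pos
  | comp _ _ ih ih' => exact ih' ⟨0, ih⟩
  | union _ _ => exact Nat.succ_pos _

theorem unorderedPair (hf : IsRudimentary n f) (hg : IsRudimentary n g) :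
    IsRudimentary n (fun v => {f v, g v}) :=
  (IsRudimentary.pair (0 : Fin 2) 1).comp (H := ![f, g]) (by
    intro i; fin_cases i <;> assumption)

theorem sdiff (hf : IsRudimentary n f) (hg : IsRudimentary n g) :
    IsRudimentary n (fun v => f v \ g v) :=
  (IsRudimentary.diff (0 : Fin 2) 1).comp (H := ![f, g]) (by
    intro i; fin_cases i <;> assumption)

theorem congr (hf : IsRudimentary n f) (h : ∀ v, f v = g v) : IsRudimentary n g := by
  rwa [← funext h]

theorem singleton (hf : IsRudimentary n f) : IsRudimentary n (fun v => {f v}) :=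
  (hf.unorderedPair hf).congr fun v => by simp

theorem biUnion {H : ZFSet.{u} → (Fin n → ZFSet.{u}) → ZFSet.{u}} (hf : IsRudimentary n f)
    (hH : IsRudimentary (n + 1) (fun w => H (w 0) (Fin.tail w))) :
    IsRudimentary n (fun v => biUnion (f v) fun y => H y v) :=
  (IsRudimentary.union hH).comp (H := Fin.cons f fun i v => v i)
    (Fin.cases hf fun i => IsRudimentary.proj i)

theorem weaken (hf : IsRudimentary n f) : IsRudimentary (n + 1) (fun w => f (Fin.tail w)) :=
  hf.comp (H := fun i w => w i.succ) fun i => .proj i.succ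

theorem sUnion (hf : IsRudimentary n f) : IsRudimentary n (fun v => ⋃₀ (f v)) :=
  (hf.biUnion (H := fun y _ => y) (.proj 0)).congr fun v => by
    ext; simp [mem_biUnion]

theorem union' (hf : IsRudimentary n f) (hg : IsRudimentary n g) :
    IsRudimentary n (fun v => f v ∪ g v) :=
  (hf.unorderedPair hg).sUnion

theorem insert (hf : IsRudimentary n f) (hg : IsRudimentary n g) :
    IsRudimentary n (fun v => insert (f v) (g v)) :=
  (hf.singleton.union' hg).congr fun v => by ext; simp

theorem kpair (hf : IsRudimentary n f) (hg : IsRudimentary n g) :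
    IsRudimentary n (fun v => ZFSet.pair (f v) (g v)) :=
  hf.singleton.unorderedPair (hf.unorderedPair hg)

theorem inter (hf : IsRudimentary n f) (hg : IsRudimentary n g) :
    IsRudimentary n (fun v => f v ∩ g v) :=
  (hf.sdiff (hf.sdiff hg)).congr fun v => by
    ext; simp +contextual

/-- The union of $\{y\}$ over all members of $F(y,v)$ is $\{y\}$ if $P$ holds at $y$ and empty
otherwise; the union of these over $y\in f(v)$ is the separated set. -/
theorem sep {P : ZFSet.{u} → (Fin n → ZFSet.{u}) → Prop} (hf : IsRudimentary n f)
    (hP : RudRel (n + 1) (fun w => P (w 0) (Fin.tail w))) :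
    IsRudimentary n (fun v => ZFSet.sep (fun z => P z v) (f v)) := by
  obtain ⟨F, hF, h⟩ := hP
  refine (hf.biUnion (H := fun y v => _root_.biUnion (F (Fin.cons y v)) fun _ => {y})
    (IsRudimentary.biUnion (H := fun _ w => {w 0}) ?_ (singleton (proj 1)))).congr fun v => ?_
  · simpa using hF
  · ext z
    simp only [mem_biUnion, mem_singleton, mem_sep]
    constructor
    · rintro ⟨y, hy, x, hx, rfl⟩
      exact ⟨hy, (h (Fin.cons z v)).2 ⟨x, hx⟩⟩
    · rintro ⟨hz, hP⟩
      obtain ⟨x, hx⟩ := (h (Fin.cons z v)).1 hP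
      exact ⟨z, hz, x, hx, rfl⟩

end IsRudimentary

namespace RudRel

variable {n : ℕ} {P Q : (Fin n → ZFSet.{u}) → Prop} {f g : (Fin n → ZFSet.{u}) → ZFSet.{u}}

theorem congr (hP : RudRel n P) (h : ∀ v, P v ↔ Q v) : RudRel n Q := by
  rwa [← funext fun v => propext (h v)]

theorem comp {k : ℕ} {P : (Fin k → ZFSet.{u}) → Prop}
    {H : Fin k → (Fin n → ZFSet.{u}) → ZFSet.{u}} (hP : RudRel k P)
    (hH : ∀ i, IsRudimentary n (H i)) : RudRel n (fun v => P fun i => H i v) := by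
  obtain ⟨F, hF, h⟩ := hP
  exact ⟨_, hF.comp hH, fun v => h _⟩

theorem mem (hf : IsRudimentary n f) (hg : IsRudimentary n g) : RudRel n (fun v => f v ∈ g v) :=
  ⟨_, hf.singleton.inter hg, fun v => by simp⟩

theorem eq (hf : IsRudimentary n f) (hg : IsRudimentary n g) : RudRel n (fun v => f v = g v) :=
  (mem hf hg.singleton).congr fun v => by simp

/-- The union of $\{F(v)\}$ over the members of $F(v)$ is $\{F(v)\}$ or $\emptyset$; its complement
in $\{F(v)\}$ is inhabited exactly when $F(v)$ is empty. -/
theorem not (hP : RudRel n P) : RudRel n (fun v => ¬ P v) := by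
  obtain ⟨F, hF, h⟩ := hP
  refine ⟨_, hF.singleton.sdiff (hF.biUnion (H := fun _ v => {F v}) hF.singleton.weaken),
    fun v => ?_⟩
  simp [h, mem_biUnion]

theorem and (hP : RudRel n P) (hQ : RudRel n Q) : RudRel n (fun v => P v ∧ Q v) := by
  obtain ⟨F, hF, h⟩ := hP
  obtain ⟨G, hG, h'⟩ := hQ
  refine ⟨_, hF.biUnion (H := fun _ v => G v) hG.weaken, fun v => ?_⟩
  simp only [h, h', mem_biUnion]
  tauto

theorem or (hP : RudRel n P) (hQ : RudRel n Q) : RudRel n (fun v => P v ∨ Q v) :=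
  (hP.not.and hQ.not).not.congr fun v => by tauto

theorem imp (hP : RudRel n P) (hQ : RudRel n Q) : RudRel n (fun v => P v → Q v) :=
  (hP.and hQ.not).not.congr fun v => by tauto

theorem iff (hP : RudRel n P) (hQ : RudRel n Q) : RudRel n (fun v => (P v ↔ Q v)) :=
  ((hP.imp hQ).and (hQ.imp hP)).congr fun v => by tauto

theorem exists_mem {P : ZFSet.{u} → (Fin n → ZFSet.{u}) → Prop} (hf : IsRudimentary n f)
    (hP : RudRel (n + 1) (fun w => P (w 0) (Fin.tail w))) :
    RudRel n (fun v => ∃ z ∈ f v, P z v) :=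
  ⟨_, hf.sep hP, fun v => by simp⟩

theorem forall_mem {P : ZFSet.{u} → (Fin n → ZFSet.{u}) → Prop} (hf : IsRudimentary n f)
    (hP : RudRel (n + 1) (fun w => P (w 0) (Fin.tail w))) :
    RudRel n (fun v => ∀ z ∈ f v, P z v) :=
  (exists_mem (P := fun z v => ¬ P z v) hf hP.not).not.congr fun v => by simp

end RudRel

namespace IsRudimentary

variable {n : ℕ} {f g : (Fin n → ZFSet.{u}) → ZFSet.{u}}

theorem fstSet (hf : IsRudimentary n f) : IsRudimentary n (fun v => fstSet (f v)) := by
  suffices h : IsRudimentary 1 (fun v => _root_.fstSet (v 0)) from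
    h.comp (H := fun _ => f) fun _ => hf
  unfold _root_.fstSet
  apply_rules [IsRudimentary.proj, IsRudimentary.biUnion, IsRudimentary.sep,
    IsRudimentary.sUnion, RudRel.eq, IsRudimentary.kpair]

theorem sndSet (hf : IsRudimentary n f) : IsRudimentary n (fun v => sndSet (f v)) := by
  suffices h : IsRudimentary 1 (fun v => _root_.sndSet (v 0)) from
    h.comp (H := fun _ => f) fun _ => hf
  unfold _root_.sndSet
  apply_rules [IsRudimentary.proj, IsRudimentary.biUnion, IsRudimentary.sep,
    IsRudimentary.sUnion, RudRel.eq, IsRudimentary.kpair]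

theorem prod (hf : IsRudimentary n f) (hg : IsRudimentary n g) :
    IsRudimentary n (fun v => (f v).prod (g v)) := by
  refine (hf.biUnion (H := fun a v => _root_.biUnion (g v) fun b => {ZFSet.pair a b})
    (hg.weaken.biUnion (H := fun b w => {ZFSet.pair (w 0) b})
      (singleton (kpair (proj 1) (proj 0))))).congr fun v => ?_
  ext z
  simp [mem_biUnion]

/-- A rudimentary function collects its values over a product of `n` sets. -/
theorem exists_iUnion_pi {K : (Fin n → ZFSet.{u}) → ZFSet.{u}} (hK : IsRudimentary n K) :
    ∃ L, IsRudimentary n L ∧ ∀ v z, z ∈ L v ↔ ∃ y, (∀ i, y i ∈ v i) ∧ z ∈ K y := by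
  -- Take the union one coordinate at a time: coordinates in $s$ range over $v_i$, the others stay
  -- fixed at $v_i$.
  suffices h : ∀ s : Finset (Fin n), ∃ L, IsRudimentary n L ∧ ∀ v z,
      z ∈ L v ↔ ∃ y, (∀ i ∈ s, y i ∈ v i) ∧ (∀ i ∉ s, y i = v i) ∧ z ∈ K y by
    simpa using h Finset.univ
  intro s
  induction s using Finset.induction_on with
  | empty =>
    refine ⟨K, hK, fun v z => ⟨fun h => ⟨v, by simp, by simp, h⟩, ?_⟩⟩
    rintro ⟨y, -, h, hz⟩
    rwa [← funext fun i => h i (by simp)]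
  | insert a s ha ih =>
    obtain ⟨L, hL, h⟩ := ih
    have hup : IsRudimentary (n + 1) (fun w => L (Function.update (Fin.tail w) a (w 0))) := by
      refine hL.comp (H := fun i w => Function.update (Fin.tail w) a (w 0) i) fun i => ?_
      by_cases hi : i = a
      · subst hi
        simpa using proj 0
      · simp only [Function.update_of_ne hi]
        exact proj i.succ
    refine ⟨_, biUnion (H := fun y v => L (Function.update v a y)) (proj a) hup, fun v z => ?_⟩
    simp only [mem_biUnion, h]
    constructor
    · rintro ⟨x, hx, y, h1, h2, hz⟩
      have hya : y a = x := by simpa using h2 a ha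
      refine ⟨y, fun i hi => ?_, fun i hi => ?_, hz⟩
      · rcases Finset.mem_insert.1 hi with rfl | hi'
        · rwa [hya]
        · have := h1 i hi'
          rwa [Function.update_of_ne (by rintro rfl; exact ha hi')] at this
      · simp only [Finset.mem_insert, not_or] at hi
        simpa [Function.update_of_ne hi.1] using h2 i hi.2
    · rintro ⟨y, h1, h2, hz⟩
      refine ⟨y a, h1 a (by simp), y, fun i hi => ?_, fun i hi => ?_, hz⟩
      · rw [Function.update_of_ne (by rintro rfl; exact ha hi)]
        exact h1 i (by simp [hi])
      · by_cases hia : i = a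
        · subst hia; simp
        · rw [Function.update_of_ne hia]
          exact h2 i (by simp [hia, hi])

end IsRudimentary

attribute [irreducible] fstSet sndSet

/-! ### Elements of rudimentarily closed sets -/

namespace RudClosed

variable {y : ZFSet.{u}}

theorem pair_mem (h : RudClosed y) {a b : ZFSet.{u}} (ha : a ∈ y) (hb : b ∈ y) :
    pair a b ∈ y :=
  h 2 _ ((IsRudimentary.proj 0).kpair (.proj 1)) ![a, b] (by intro i; fin_cases i <;> assumption)

theorem insert_mem (h : RudClosed y) {a b : ZFSet.{u}} (ha : a ∈ y) (hb : b ∈ y) :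
    insert a b ∈ y :=
  h 2 _ ((IsRudimentary.proj 0).insert (.proj 1)) ![a, b]
    (by intro i; fin_cases i <;> assumption)

theorem prod_mem (h : RudClosed y) {a b : ZFSet.{u}} (ha : a ∈ y) (hb : b ∈ y) :
    a.prod b ∈ y :=
  h 2 _ ((IsRudimentary.proj 0).prod (.proj 1)) ![a, b]
    (by intro i; fin_cases i <;> assumption)

theorem inter_mem (h : RudClosed y) {a b : ZFSet.{u}} (ha : a ∈ y) (hb : b ∈ y) :
    a ∩ b ∈ y :=
  h 2 _ ((IsRudimentary.proj 0).inter (.proj 1)) ![a, b]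
    (by intro i; fin_cases i <;> assumption)

/-- Every finite subset of a rudimentarily closed set containing `∅` is an element of it. -/
theorem mem_of_finite (h : RudClosed y) (h0 : ∅ ∈ y) {x : ZFSet.{u}}
    (hx : (x : Set ZFSet.{u}).Finite) (hxy : x ⊆ y) : x ∈ y := by
  suffices H : ∀ s : Set ZFSet.{u}, s.Finite → s ⊆ y → ∃ z ∈ y, (z : Set ZFSet.{u}) = s by
    obtain ⟨z, hz, hzx⟩ := H x hx fun a ha => hxy ha
    rwa [← SetLike.coe_injective hzx]
  intro s hs
  induction s, hs using Set.Finite.induction_on with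
  | empty => exact fun _ => ⟨∅, h0, by simp⟩
  | @insert a s _ _ ih =>
    intro hsy
    obtain ⟨z, hz, rfl⟩ := ih fun b hb => hsy (Set.mem_insert_of_mem _ hb)
    exact ⟨insert a z, h.insert_mem (hsy (Set.mem_insert _ _)) hz, by simp⟩

end RudClosed

/-! ### The set `J1` -/

theorem rudClosed_J1 : RudClosed J1.{u} := (rudClosure_spec _).1.2.2

theorem empty_mem_J1 : ∅ ∈ J1.{u} := (rudClosure_spec _).1.2.1

theorem rudClosed_vonNeumann_omega0 : RudClosed (vonNeumann Ordinal.omega0.{u}) := by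
  intro n F hF v hv
  obtain ⟨k, hk⟩ := hF.rank_le
  choose m hm using fun i => Ordinal.lt_omega0.1 (mem_vonNeumann.1 (hv i))
  refine mem_vonNeumann.2 ((hk (Finset.univ.sup m : ℕ) v fun i => ?_).trans_lt ?_)
  · rw [hm]
    exact_mod_cast Finset.le_sup (Finset.mem_univ i)
  · rw [← Nat.cast_add]
    exact Ordinal.natCast_lt_omega0 _

theorem finite_of_mem_vonNeumann_omega0 {x : ZFSet.{u}} (hx : x ∈ vonNeumann Ordinal.omega0) :
    (x : Set ZFSet.{u}).Finite := by
  have h : ∀ n : ℕ, ((vonNeumann (n : Ordinal.{u})) : Set ZFSet.{u}).Finite := by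
    intro n
    induction n with
    | zero => simp
    | succ n ih =>
      rw [Nat.cast_succ, vonNeumann_add_one]
      refine Set.Finite.of_finite_image (f := SetLike.coe) (ih.finite_subsets.subset ?_)
        SetLike.coe_injective.injOn
      rintro _ ⟨z, hz, rfl⟩
      exact fun a ha => mem_powerset.1 hz ha
  obtain ⟨n, hn⟩ := Ordinal.lt_omega0.1 (mem_vonNeumann.1 hx)
  refine (h n).subset fun a ha => ?_
  rw [← hn]
  exact subset_vonNeumann_self x ha

/-- $V_\omega$ is rudimentarily closed, since ranks grow by finite amounts, so it includes $J_1$ by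
minimality. Conversely, by $\in$-induction, each of its elements is a finite subset of $J_1$. -/
theorem J1_eq_vonNeumann : J1.{u} = vonNeumann Ordinal.omega0 := by
  apply SetLike.coe_injective
  apply Set.Subset.antisymm
  · exact (rudClosure_spec _).2 _ (empty_subset _) (mem_vonNeumann.2 (by simp))
      rudClosed_vonNeumann_omega0
  · intro x
    induction x using inductionOn with
    | h x ih =>
    exact fun hx => rudClosed_J1.mem_of_finite empty_mem_J1
      (finite_of_mem_vonNeumann_omega0 hx)
      fun a ha => ih a ha (isTransitive_vonNeumann _ _ hx ha)

theorem isTransitive_J1 : J1.{u}.IsTransitive :=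
  J1_eq_vonNeumann ▸ isTransitive_vonNeumann _

theorem finite_of_mem_J1 {x : ZFSet.{u}} (hx : x ∈ J1) : (x : Set ZFSet.{u}).Finite :=
  finite_of_mem_vonNeumann_omega0 (J1_eq_vonNeumann ▸ hx)

theorem mem_J1_of_finite {x : ZFSet.{u}} (hx : (x : Set ZFSet.{u}).Finite) (hxy : x ⊆ J1) :
    x ∈ J1 :=
  rudClosed_J1.mem_of_finite empty_mem_J1 hx hxy

/-- Any two elements of `J1` lie in a common transitive element of `J1`. -/
theorem exists_isTransitive_mem_J1 {x y : ZFSet.{u}} (hx : x ∈ J1) (hy : y ∈ J1) :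
    ∃ t ∈ J1, t.IsTransitive ∧ x ∈ t ∧ y ∈ t := by
  rw [J1_eq_vonNeumann] at *
  have hx' := mem_vonNeumann.1 hx
  have hy' := mem_vonNeumann.1 hy
  refine ⟨vonNeumann (Order.succ (max x.rank y.rank)), ?_, isTransitive_vonNeumann _,
    mem_vonNeumann.2 (by simp), mem_vonNeumann.2 (by simp)⟩
  exact vonNeumann_mem_of_lt (Ordinal.isSuccLimit_omega0.succ_lt (max_lt hx' hy'))

/-! ### The set `J2` -/

theorem rudClosed_J2 : RudClosed J2.{u} := (rudClosure_spec _).1.2.2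

theorem J1_mem_J2 : J1.{u} ∈ J2.{u} := (rudClosure_spec _).1.2.1

theorem J1_subset_J2 : J1.{u} ⊆ J2.{u} := (rudClosure_spec _).1.1

theorem empty_mem_J2 : ∅ ∈ J2.{u} := J1_subset_J2 empty_mem_J1

/-! ### Natural numbers -/

/-- The von Neumann natural number `n`. -/
noncomputable def natSet (n : ℕ) : ZFSet.{u} := (n : Ordinal.{u}).toZFSet

theorem natSet_zero : natSet.{u} 0 = ∅ := by simp [natSet]

theorem natSet_succ (n : ℕ) : natSet.{u} (n + 1) = insert (natSet n) (natSet n) := by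
  simp [natSet, Ordinal.toZFSet_add_one]

theorem natSet_injective : Function.Injective natSet.{u} := fun m n h => by
  exact_mod_cast Ordinal.toZFSet_injective h

theorem mem_natSet {n : ℕ} {x : ZFSet.{u}} : x ∈ natSet n ↔ ∃ m < n, x = natSet m := by
  induction n with
  | zero => simp [natSet_zero]
  | succ n ih =>
    rw [natSet_succ, mem_insert_iff, ih]
    constructor
    · rintro (rfl | ⟨m, hm, rfl⟩)
      exacts [⟨n, by omega, rfl⟩, ⟨m, by omega, rfl⟩]
    · rintro ⟨m, hm, rfl⟩
      rcases Nat.lt_succ_iff_lt_or_eq.1 hm with h | rfl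
      exacts [Or.inr ⟨m, h, rfl⟩, Or.inl rfl]

theorem mem_omega_iff {x : ZFSet.{u}} : x ∈ (omega : ZFSet.{u}) ↔ ∃ n, x = natSet n := by
  have h : ∀ n, mk (PSet.ofNat n) = natSet.{u} n := by
    intro n
    induction n with
    | zero => exact natSet_zero.symm
    | succ n ih => rw [natSet_succ, ← ih]; rfl
  constructor
  · induction x using Quotient.inductionOn with
    | h x =>
    rintro ⟨⟨n⟩, hn⟩
    exact ⟨n, by rw [← h]; exact sound hn⟩
  · rintro ⟨n, rfl⟩
    induction n with
    | zero => rw [natSet_zero]; exact omega_zero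
    | succ n ih => rw [natSet_succ]; exact omega_succ ih

theorem natSet_mem_J1 (n : ℕ) : natSet.{u} n ∈ J1 := by
  induction n with
  | zero => rw [natSet_zero]; exact empty_mem_J1
  | succ n ih => rw [natSet_succ]; exact rudClosed_J1.insert_mem ih ih

/-- A definition of $\omega$ with bounded quantifiers, used to separate it from $J_1$. Writing
emptiness as $m=m\setminus m$ avoids a constant for $\emptyset$. -/
theorem mem_omega_iff_forall {x : ZFSet.{u}} : x ∈ (omega : ZFSet.{u}) ↔
    ∀ m ∈ insert x x, m = m \ m ∨ ∃ k ∈ m, m = insert k k := by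
  have h0 : ∀ m : ZFSet.{u}, m = m \ m ↔ m = ∅ := fun m => by
    rw [show m \ m = ∅ by ext; simp]
  simp only [h0, mem_omega_iff]
  constructor
  · rintro ⟨n, rfl⟩ m hm
    rw [← natSet_succ] at hm
    obtain ⟨k, -, rfl⟩ := mem_natSet.1 hm
    cases k with
    | zero => exact Or.inl natSet_zero
    | succ k => exact Or.inr ⟨natSet k, by simp [natSet_succ], natSet_succ k⟩
  · induction x using inductionOn with
    | h x ih =>
    intro h
    rcases h x (by simp) with rfl | ⟨k, hk, hx⟩
    · exact ⟨0, natSet_zero.symm⟩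
    · obtain ⟨n, rfl⟩ := ih k hk fun m hm => h m (mem_insert_of_mem _ (hx ▸ hm))
      exact ⟨n + 1, hx.trans (natSet_succ n).symm⟩

theorem omega_mem_J2 : (omega : ZFSet.{u}) ∈ J2.{u} := by
  have h : IsRudimentary 1 (fun v : Fin 1 → ZFSet.{u} =>
      (v 0).sep fun x => ∀ m ∈ insert x x, m = m \ m ∨ ∃ k ∈ m, m = insert k k) := by
    apply_rules [IsRudimentary.proj, IsRudimentary.sep, IsRudimentary.insert, RudRel.forall_mem,
      RudRel.exists_mem, RudRel.or, RudRel.eq, IsRudimentary.sdiff]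
  convert rudClosed_J2 1 _ h (fun _ => J1) fun _ => J1_mem_J2
  ext x
  rw [mem_sep, ← mem_omega_iff_forall]
  refine ⟨fun hx => ⟨?_, hx⟩, And.right⟩
  obtain ⟨n, rfl⟩ := mem_omega_iff.1 hx
  exact natSet_mem_J1 n

/-! ### Ackermann's coding -/

/-- Ackermann's code of a hereditarily finite set. -/
noncomputable def code (x : ZFSet.{u}) : ℕ :=
  -- Summing over the set of codes makes the powers distinct even before injectivity is known. An
  -- infinite set of codes would give the default value 0; elements of $J_1$ are finite.
  ∑ᶠ i ∈ Set.range fun y : x => code y.1, 2 ^ i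
termination_by x
decreasing_by exact y.2

theorem exists_code_eq_sum {x : ZFSet.{u}} (hx : x ∈ J1) : ∃ s : Finset ℕ,
    (∀ i, i ∈ s ↔ ∃ y ∈ x, code y = i) ∧ code x = ∑ i ∈ s, 2 ^ i := by
  have h : (Set.range fun y : x => code y.1).Finite := by
    have := (finite_of_mem_J1 hx).to_subtype
    exact Set.finite_range (ι := (x : Set ZFSet.{u})) fun y => code y.1
  refine ⟨h.toFinset, fun i => by simp, ?_⟩
  rw [code]
  exact finsum_mem_eq_finite_toFinset_sum _ h

/-- Binary expansions are unique, so equal codes mean equal sets of codes of elements;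
$\in$-induction finishes. -/
theorem code_injOn : Set.InjOn code (J1 : Set ZFSet.{u}) := by
  intro x
  induction x using inductionOn with
  | h x ih =>
  intro hx y hy hxy
  obtain ⟨s, hs, hsx⟩ := exists_code_eq_sum hx
  obtain ⟨t, ht, hty⟩ := exists_code_eq_sum hy
  obtain rfl : s = t := Finset.geomSum_injective le_rfl (hsx.symm.trans (hxy.trans hty))
  ext z
  constructor
  · intro hz
    obtain ⟨w, hw, h⟩ := (ht _).1 ((hs _).2 ⟨z, hz, rfl⟩)
    rwa [ih z hz (isTransitive_J1 _ hx hz) (isTransitive_J1 _ hy hw) h.symm]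
  · intro hz
    obtain ⟨w, hw, h⟩ := (hs _).1 ((ht _).2 ⟨z, hz, rfl⟩)
    rwa [← ih w hw (isTransitive_J1 _ hx hw) (isTransitive_J1 _ hy hz) h]

/-- Binary numbers are compared at the highest digit where they differ. This turns the ordering into
a recursion that mentions no arithmetic. -/
theorem code_lt_code_iff {x y : ZFSet.{u}} (hx : x ∈ J1) (hy : y ∈ J1) :
    code x < code y ↔ ∃ z ∈ y, z ∉ x ∧ ∀ w ∈ x ∪ y, code z < code w → (w ∈ x ↔ w ∈ y) := by
  obtain ⟨s, hs, hsx⟩ := exists_code_eq_sum hx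
  obtain ⟨t, ht, hty⟩ := exists_code_eq_sum hy
  have hmem : ∀ {a b : ZFSet.{u}}, b ∈ J1 → a ∈ J1 → ((∃ c ∈ b, code c = code a) ↔ a ∈ b) := by
    intro a b hb ha
    refine ⟨?_, fun h => ⟨a, h, rfl⟩⟩
    rintro ⟨c, hc, h⟩
    rwa [← code_injOn (isTransitive_J1 _ hb hc) ha h]
  rw [hsx, hty, Finset.geomSum_lt_geomSum_iff_toColex_lt_toColex le_rfl,
    Finset.Colex.lt_iff_exists_filter_lt]
  simp only [Finset.mem_sdiff, Finset.ext_iff, Finset.mem_filter]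
  constructor
  · rintro ⟨i, ⟨hit, his⟩, h⟩
    obtain ⟨z, hz, rfl⟩ := (ht _).1 hit
    have hzJ := isTransitive_J1 _ hy hz
    refine ⟨z, hz, fun hzx => his ((hs _).2 ⟨z, hzx, rfl⟩), fun w hw hlt => ?_⟩
    have hwJ : w ∈ J1 := (mem_union.1 hw).elim (isTransitive_J1 _ hx ·) (isTransitive_J1 _ hy ·)
    have := h (code w)
    rw [hs, ht, hmem hx hwJ, hmem hy hwJ] at this
    tauto
  · rintro ⟨z, hz, hzx, h⟩
    have hzJ := isTransitive_J1 _ hy hz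
    refine ⟨code z, ⟨(ht _).2 ⟨z, hz, rfl⟩, fun hc => hzx ((hmem hx hzJ).1 ((hs _).1 hc))⟩,
      fun i => ⟨?_, ?_⟩⟩
    · rintro ⟨hi, hlt⟩
      obtain ⟨w, hw, rfl⟩ := (hs _).1 hi
      exact ⟨(ht _).2 ⟨w, (h w (mem_union.2 (Or.inl hw)) hlt).1 hw, rfl⟩, hlt⟩
    · rintro ⟨hi, hlt⟩
      obtain ⟨w, hw, rfl⟩ := (ht _).1 hi
      exact ⟨(hs _).2 ⟨w, (h w (mem_union.2 (Or.inr hw)) hlt).2 hw, rfl⟩, hlt⟩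

/-! ### Subsets of $J_2$ covered by $J_1$ -/

/-- A sequence of `n + 1` sets, coded by iterated Kuratowski pairs. -/
noncomputable def tupleSet : (n : ℕ) → (Fin (n + 1) → ZFSet.{u}) → ZFSet.{u}
  | 0, v => v 0
  | n + 1, v => pair (v 0) (tupleSet n (Fin.tail v))

theorem isRudimentary_tupleSet (n : ℕ) : IsRudimentary (n + 1) (tupleSet.{u} n) := by
  induction n with
  | zero => exact .proj 0
  | succ n ih => exact (IsRudimentary.proj 0).kpair ih.weaken

theorem tupleSet_injective (n : ℕ) : Function.Injective (tupleSet.{u} n) := by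
  induction n with
  | zero =>
    intro v w h
    ext1 i
    rw [Fin.fin_one_eq_zero i]
    exact h
  | succ n ih =>
    intro v w h
    obtain ⟨h0, h⟩ := pair_inj.1 h
    rw [← Fin.cons_self_tail v, ← Fin.cons_self_tail w, h0, ih h]

/-- `S` is a subset of `J2` which is the image of a subset of `J1` under a function in `J2`. -/
def Covered (S : ZFSet.{u}) : Prop :=
  S ⊆ J2 ∧ ∃ f ∈ J2, (∀ p ∈ f, ∃ a ∈ J1, ∃ y ∈ S, p = pair a y) ∧
    (∀ y ∈ S, ∃ a ∈ J1, pair a y ∈ f) ∧ ∀ a y z, pair a y ∈ f → pair a z ∈ f → y = z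

namespace Covered

variable {S T : ZFSet.{u}}

theorem J1 : Covered J1.{u} := by
  have h : IsRudimentary 1 fun v : Fin 1 → ZFSet.{u} => biUnion (v 0) fun a => {pair a a} := by
    apply_rules [IsRudimentary.proj, IsRudimentary.biUnion, IsRudimentary.singleton,
      IsRudimentary.kpair]
  refine ⟨J1_subset_J2, _, rudClosed_J2 1 _ h (fun _ => _root_.J1) fun _ => J1_mem_J2, ?_, ?_, ?_⟩
  · simp only [mem_biUnion, mem_singleton]
    rintro p ⟨a, ha, rfl⟩
    exact ⟨a, ha, a, ha, rfl⟩
  · intro y hy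
    simp only [mem_biUnion, mem_singleton]
    exact ⟨y, hy, y, hy, rfl⟩
  · simp only [mem_biUnion, mem_singleton, pair_inj]
    rintro a y z ⟨b, -, rfl, rfl⟩ ⟨c, -, rfl, rfl⟩
    rfl

theorem singleton {c : ZFSet.{u}} (hc : c ∈ J2) : Covered {c} := by
  refine ⟨fun x hx => mem_singleton.1 hx ▸ hc, {pair ∅ c}, ?_, ?_, ?_, ?_⟩
  · rw [← pair_eq_singleton]
    have := rudClosed_J2.pair_mem empty_mem_J2 hc
    exact rudClosed_J2 1 _ (IsRudimentary.pair 0 0) (fun _ => pair ∅ c) fun _ => this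
  · intro p hp
    exact ⟨∅, empty_mem_J1, c, by simp, mem_singleton.1 hp⟩
  · intro y hy
    rw [mem_singleton.1 hy]
    exact ⟨∅, empty_mem_J1, by simp⟩
  · simp only [mem_singleton, pair_inj]
    rintro a y z ⟨-, rfl⟩ ⟨-, rfl⟩
    rfl

/-- Tag the indices: $a$ becomes $\langle\emptyset,a\rangle$ for $S$ and
$\langle\{\emptyset\},a\rangle$ for $T$, so the two covering functions cannot conflict. -/
theorem union (hS : Covered S) (hT : Covered T) : Covered (S ∪ T) := by
  obtain ⟨hSJ, f, hf, hfp, hfs, hff⟩ := hS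
  obtain ⟨hTJ, g, hg, hgp, hgs, hgf⟩ := hT
  have h01 : (∅ : ZFSet.{u}) ≠ {∅} := fun h => by
    simpa [← h] using mem_singleton.2 (rfl : (∅ : ZFSet.{u}) = ∅)
  have h1 : ({∅} : ZFSet.{u}) ∈ _root_.J1 := by
    rw [← pair_eq_singleton]
    exact rudClosed_J1 1 _ (IsRudimentary.pair 0 0) (fun _ => ∅) fun _ => empty_mem_J1
  have h : IsRudimentary 4 fun v : Fin 4 → ZFSet.{u} =>
      biUnion (v 0) (fun p => {pair (pair (v 2) (fstSet p)) (sndSet p)}) ∪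
      biUnion (v 1) (fun p => {pair (pair (v 3) (fstSet p)) (sndSet p)}) := by
    apply_rules [IsRudimentary.proj, IsRudimentary.biUnion, IsRudimentary.singleton,
      IsRudimentary.kpair, IsRudimentary.union', IsRudimentary.fstSet, IsRudimentary.sndSet]
  have hmem : ∀ q, q ∈ (biUnion f (fun p => {pair (pair ∅ (fstSet p)) (sndSet p)}) ∪
      biUnion g (fun p => {pair (pair {∅} (fstSet p)) (sndSet p)}) : ZFSet.{u}) ↔
      (∃ a y, pair a y ∈ f ∧ q = pair (pair ∅ a) y) ∨
      (∃ a y, pair a y ∈ g ∧ q = pair (pair {∅} a) y) := by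
    intro q
    simp only [mem_union, mem_biUnion, mem_singleton]
    refine or_congr ⟨?_, ?_⟩ ⟨?_, ?_⟩
    · rintro ⟨p, hp, rfl⟩
      obtain ⟨a, -, y, -, rfl⟩ := hfp p hp
      exact ⟨a, y, hp, by simp⟩
    · rintro ⟨a, y, h, rfl⟩
      exact ⟨_, h, by simp⟩
    · rintro ⟨p, hp, rfl⟩
      obtain ⟨a, -, y, -, rfl⟩ := hgp p hp
      exact ⟨a, y, hp, by simp⟩
    · rintro ⟨a, y, h, rfl⟩
      exact ⟨_, h, by simp⟩
  refine ⟨fun x hx => (mem_union.1 hx).elim (hSJ ·) (hTJ ·), _,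
    rudClosed_J2 4 _ h ![f, g, ∅, {∅}] ?_, fun q hq => ?_, fun y hy => ?_,
    fun c y z hy hz => ?_⟩
  · intro i
    fin_cases i
    exacts [hf, hg, empty_mem_J2, J1_subset_J2 h1]
  · rcases (hmem q).1 hq with ⟨a, y, h, rfl⟩ | ⟨a, y, h, rfl⟩
    · obtain ⟨b, hb, w, hw, h⟩ := hfp _ h
      obtain ⟨rfl, rfl⟩ := pair_inj.1 h
      exact ⟨_, rudClosed_J1.pair_mem empty_mem_J1 hb, _, mem_union.2 (Or.inl hw), rfl⟩
    · obtain ⟨b, hb, w, hw, h⟩ := hgp _ h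
      obtain ⟨rfl, rfl⟩ := pair_inj.1 h
      exact ⟨_, rudClosed_J1.pair_mem h1 hb, _, mem_union.2 (Or.inr hw), rfl⟩
  · rcases mem_union.1 hy with hy | hy
    · obtain ⟨a, ha, h⟩ := hfs y hy
      exact ⟨_, rudClosed_J1.pair_mem empty_mem_J1 ha, (hmem _).2 (Or.inl ⟨a, y, h, rfl⟩)⟩
    · obtain ⟨a, ha, h⟩ := hgs y hy
      exact ⟨_, rudClosed_J1.pair_mem h1 ha, (hmem _).2 (Or.inr ⟨a, y, h, rfl⟩)⟩
  · rcases (hmem _).1 hy with ⟨a, y', h, e⟩ | ⟨a, y', h, e⟩ <;>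
    rcases (hmem _).1 hz with ⟨b, z', h', e'⟩ | ⟨b, z', h', e'⟩ <;>
    obtain ⟨rfl, rfl⟩ := pair_inj.1 e <;>
    obtain ⟨k, rfl⟩ := pair_inj.1 e' <;>
    obtain ⟨e, rfl⟩ := pair_inj.1 k
    · exact hff _ _ _ h h'
    · exact absurd e h01
    · exact absurd e.symm h01
    · exact hgf _ _ _ h h'

/-- $F(y_1,\dots,y_n)$ is indexed by the tuple of indices of the $y_i$, which is again in $J_1$. -/
theorem image {n : ℕ} {F : (Fin n → ZFSet.{u}) → ZFSet.{u}} (hF : IsRudimentary n F)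
    (hS : Covered S) :
    ∃ T, Covered T ∧ ∀ z, z ∈ T ↔ ∃ v : Fin n → ZFSet.{u}, (∀ i, v i ∈ S) ∧ z = F v := by
  obtain ⟨hSJ, f, hf, hfp, hfs, hff⟩ := hS
  obtain ⟨n, rfl⟩ := Nat.exists_eq_succ_of_ne_zero hF.pos.ne'
  have h1 : IsRudimentary (n + 1) fun p : Fin (n + 1) → ZFSet.{u} =>
      {pair (tupleSet n fun i => fstSet (p i)) (F fun i => sndSet (p i))} :=
    (((isRudimentary_tupleSet n).comp fun i => (IsRudimentary.proj i).fstSet).kpair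
      (hF.comp fun i => (IsRudimentary.proj i).sndSet)).singleton
  have h2 : IsRudimentary (n + 1) fun p : Fin (n + 1) → ZFSet.{u} => {F fun i => sndSet (p i)} :=
    (hF.comp fun i => (IsRudimentary.proj i).sndSet).singleton
  obtain ⟨L, hL, hLm⟩ := h1.exists_iUnion_pi
  obtain ⟨R, hR, hRm⟩ := h2.exists_iUnion_pi
  have key : ∀ p : Fin (n + 1) → ZFSet.{u}, (∀ i, p i ∈ f) →
      ∃ a y : Fin (n + 1) → ZFSet.{u}, (∀ i, a i ∈ _root_.J1) ∧ (∀ i, y i ∈ S) ∧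
        (∀ i, pair (a i) (y i) ∈ f) ∧ p = fun i => pair (a i) (y i) := by
    intro p hp
    choose a ha y hy h using fun i => hfp _ (hp i)
    exact ⟨a, y, ha, hy, fun i => h i ▸ hp i, funext h⟩
  have hLm' : ∀ q, q ∈ L (fun _ => f) ↔ ∃ a y : Fin (n + 1) → ZFSet.{u},
      (∀ i, a i ∈ _root_.J1) ∧ (∀ i, y i ∈ S) ∧ (∀ i, pair (a i) (y i) ∈ f) ∧
        q = pair (tupleSet n a) (F y) := by
    intro q
    rw [hLm]
    constructor
    · rintro ⟨p, hp, hq⟩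
      obtain ⟨a, y, ha, hy, h, rfl⟩ := key p hp
      exact ⟨a, y, ha, hy, h, by simpa using hq⟩
    · rintro ⟨a, y, -, -, h, rfl⟩
      exact ⟨fun i => pair (a i) (y i), h, by simp⟩
  have hRm' : ∀ z, z ∈ R (fun _ => f) ↔
      ∃ v : Fin (n + 1) → ZFSet.{u}, (∀ i, v i ∈ S) ∧ z = F v := by
    intro z
    rw [hRm]
    constructor
    · rintro ⟨p, hp, hq⟩
      obtain ⟨a, y, -, hy, -, rfl⟩ := key p hp
      exact ⟨y, hy, by simpa using hq⟩
    · rintro ⟨y, hy, rfl⟩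
      choose a ha h using fun i => hfs _ (hy i)
      exact ⟨fun i => pair (a i) (y i), h, by simp⟩
  refine ⟨R fun _ => f, ⟨fun z hz => ?_, L fun _ => f, rudClosed_J2 _ _ hL _ fun _ => hf,
    fun q hq => ?_, fun z hz => ?_, fun c y z hy hz => ?_⟩, hRm'⟩
  · obtain ⟨v, hv, rfl⟩ := (hRm' z).1 hz
    exact rudClosed_J2 _ _ hF _ fun i => hSJ (hv i)
  · obtain ⟨a, y, ha, hy, -, rfl⟩ := (hLm' q).1 hq
    exact ⟨_, rudClosed_J1 _ _ (isRudimentary_tupleSet n) _ ha, _, (hRm' _).2 ⟨y, hy, rfl⟩, rfl⟩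
  · obtain ⟨v, hv, rfl⟩ := (hRm' z).1 hz
    choose a ha h using fun i => hfs _ (hv i)
    exact ⟨_, rudClosed_J1 _ _ (isRudimentary_tupleSet n) _ ha, (hLm' _).2 ⟨a, v, ha, hv, h, rfl⟩⟩
  · obtain ⟨a, v, -, -, h, e⟩ := (hLm' _).1 hy
    obtain ⟨b, w, -, -, h', e'⟩ := (hLm' _).1 hz
    obtain ⟨rfl, rfl⟩ := pair_inj.1 e
    obtain ⟨k, rfl⟩ := pair_inj.1 e'
    obtain rfl := tupleSet_injective n k
    rw [funext fun i => hff _ _ _ (h i) (h' i)]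

end Covered

/-- Adjoining the values of a rudimentary function to a transitive covered set. -/
theorem Covered.exists_adjoin {n : ℕ} {F : (Fin n → ZFSet.{u}) → ZFSet.{u}}
    (hF : IsRudimentary n F) {S T : ZFSet.{u}} (hS : Covered S) (hT : Covered T)
    (hTt : T.IsTransitive) (hST : S ⊆ T) (h : ∀ v, (∀ i, v i ∈ S) → F v ⊆ T) :
    ∃ U : ZFSet.{u}, U.IsTransitive ∧ Covered U ∧ S ⊆ U ∧ ∀ v, (∀ i, v i ∈ S) → F v ∈ U := by
  obtain ⟨I, hI, hIm⟩ := hS.image hF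
  refine ⟨T ∪ I, fun x hx z hz => mem_union.2 (Or.inl ?_), hT.union hI,
    fun x hx => mem_union.2 (Or.inl (hST hx)),
    fun v hv => mem_union.2 (Or.inr ((hIm _).2 ⟨v, hv, rfl⟩))⟩
  rcases mem_union.1 hx with hx | hx
  · exact hTt x hx hz
  · obtain ⟨v, hv, rfl⟩ := (hIm x).1 hx
    exact h v hv hz

/-- Induction on how $F$ is generated. In the union case transitivity is used twice: it puts the
bound variable $y\in v_0$ into $T$, and it makes the union a subset of the set $U$ that absorbs the
values of $H$. -/
theorem IsRudimentary.exists_covered {n : ℕ} {F : (Fin n → ZFSet.{u}) → ZFSet.{u}}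
    (hF : IsRudimentary n F) {T : ZFSet.{u}} (hTt : T.IsTransitive) (hT : Covered T) :
    ∃ U : ZFSet.{u}, U.IsTransitive ∧ Covered U ∧ T ⊆ U ∧ ∀ v, (∀ i, v i ∈ T) → F v ∈ U := by
  induction hF generalizing T with
  | proj i => exact ⟨T, hTt, hT, fun x hx => hx, fun v hv => hv i⟩
  | pair i j =>
    refine hT.exists_adjoin (.pair i j) hT hTt (fun x hx => hx) fun v hv z hz => ?_
    rcases mem_pair.1 hz with rfl | rfl
    exacts [hv i, hv j]
  | diff i j =>
    exact hT.exists_adjoin (.diff i j) hT hTt (fun x hx => hx) fun v hv z hz =>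
      hTt _ (hv i) (mem_sdiff.1 hz).1
  | @comp n k G H hG hH ihG ihH =>
    have : ∀ s : Finset (Fin k), ∃ U : ZFSet.{u}, U.IsTransitive ∧ Covered U ∧ T ⊆ U ∧
        ∀ i ∈ s, ∀ v, (∀ j, v j ∈ T) → H i v ∈ U := by
      intro s
      induction s using Finset.induction_on with
      | empty => exact ⟨T, hTt, hT, fun x hx => hx, by simp⟩
      | insert a s _ ih =>
        obtain ⟨U, hUt, hU, hTU, h⟩ := ih
        obtain ⟨V, hVt, hV, hUV, h'⟩ := ihH a hUt hU
        refine ⟨V, hVt, hV, fun x hx => hUV (hTU hx), fun i hi v hv => ?_⟩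
        rcases Finset.mem_insert.1 hi with rfl | hi
        · exact h' v fun j => hTU (hv j)
        · exact hUV (h i hi v hv)
    obtain ⟨U, hUt, hU, hTU, h⟩ := this Finset.univ
    obtain ⟨V, hVt, hV, hUV, h'⟩ := ihG hUt hU
    exact ⟨V, hVt, hV, fun x hx => hUV (hTU hx),
      fun v hv => h' _ fun i => h i (Finset.mem_univ i) v hv⟩
  | @union n H hH ih =>
    obtain ⟨U, hUt, hU, hTU, h⟩ := ih hTt hT
    refine hT.exists_adjoin (.union hH) hU hUt hTU fun v hv z hz => ?_
    obtain ⟨y, hy⟩ := mem_iUnion.1 hz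
    refine hUt _ (h _ fun i => ?_) hy
    refine Fin.cases ?_ (fun j => ?_) i
    · exact hTt _ (hv 0) y.2
    · exact hv j.succ

/-- The elements of $J_2$ with this property include $J_1$ and $J_1$ itself and are rudimentarily
closed, so minimality of $J_2$ applies. -/
theorem exists_covered_of_mem_J2 {x : ZFSet.{u}} (hx : x ∈ J2) :
    ∃ T : ZFSet.{u}, T.IsTransitive ∧ Covered T ∧ x ∈ T := by
  refine (mem_sep.1 ((rudClosure_spec J1.{u}).2 (ZFSet.sep (fun x => ∃ T : ZFSet.{u},
    T.IsTransitive ∧ Covered T ∧ x ∈ T) J2) (fun a ha => ?_) ?_ ?_ hx)).2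
  · exact mem_sep.2 ⟨J1_subset_J2 ha, J1, isTransitive_J1, Covered.J1, ha⟩
  · refine mem_sep.2 ⟨J1_mem_J2, J1 ∪ {J1}, fun y hy z hz => ?_,
      Covered.J1.union (Covered.singleton J1_mem_J2), by simp⟩
    rcases mem_union.1 hy with hy | hy
    · exact mem_union.2 (Or.inl (isTransitive_J1 y hy hz))
    · exact mem_union.2 (Or.inl (mem_singleton.1 hy ▸ hz))
  · intro n F hF v hv
    have : ∀ s : Finset (Fin n), ∃ T : ZFSet.{u}, T.IsTransitive ∧ Covered T ∧
        ∀ i ∈ s, v i ∈ T := by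
      intro s
      induction s using Finset.induction_on with
      | empty => exact ⟨J1, isTransitive_J1, Covered.J1, by simp⟩
      | insert a s _ ih =>
        obtain ⟨T, hTt, hT, h⟩ := ih
        obtain ⟨-, U, hUt, hU, ha⟩ := mem_sep.1 (hv a)
        refine ⟨T ∪ U, hTt.union hUt, hT.union hU, fun i hi => mem_union.2 ?_⟩
        rcases Finset.mem_insert.1 hi with rfl | hi
        exacts [Or.inr ha, Or.inl (h i hi)]
    obtain ⟨T, hTt, hT, h⟩ := this Finset.univ
    obtain ⟨U, hUt, hU, -, h'⟩ := hF.exists_covered hTt hT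
    exact mem_sep.2 ⟨rudClosed_J2 n F hF v fun i => (mem_sep.1 (hv i)).1, U, hUt, hU,
      h' v fun i => h i (Finset.mem_univ i)⟩

theorem isTransitive_J2 : J2.{u}.IsTransitive := by
  intro x hx y hy
  obtain ⟨T, hTt, hT, hxT⟩ := exists_covered_of_mem_J2 hx
  exact hT.1 (hTt x hxT hy)

/-! ### Ackermann's ordering as an element of $J_2$ -/

/-- `R` satisfies the recursion for Ackermann's ordering on the elements of `t`. -/
def IsAckermannRel (R t : ZFSet.{u}) : Prop :=
  ∀ a ∈ t, ∀ b ∈ t, (pair a b ∈ R ↔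
    ∃ z ∈ b, z ∉ a ∧ ∀ w ∈ a ∪ b, pair z w ∈ R → (w ∈ a ↔ w ∈ b))

theorem RudRel.isAckermannRel {n : ℕ} {f g : (Fin n → ZFSet.{u}) → ZFSet.{u}}
    (hf : IsRudimentary n f) (hg : IsRudimentary n g) :
    RudRel n fun v => IsAckermannRel (f v) (g v) := by
  suffices h : RudRel 2 fun v => IsAckermannRel (v 0) (v 1) from
    h.comp (H := ![f, g]) (by intro i; fin_cases i <;> assumption)
  unfold IsAckermannRel
  apply_rules [IsRudimentary.proj, RudRel.exists_mem, RudRel.forall_mem,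
    RudRel.not, RudRel.and, RudRel.iff, RudRel.imp, RudRel.mem, IsRudimentary.kpair,
    IsRudimentary.union']

/-- The recursion at $(a,b)$ consults only pairs of elements of $a\cup b$, so induction on a common
bound for the ranks shows that it has one solution on $t$. -/
theorem IsAckermannRel.pair_mem_iff {R t : ZFSet.{u}} (h : IsAckermannRel R t)
    (ht : t.IsTransitive) (htJ : t ⊆ J1) {a b : ZFSet.{u}} (ha : a ∈ t) (hb : b ∈ t) :
    pair a b ∈ R ↔ code a < code b := by
  suffices H : ∀ (o : Ordinal.{u}) (a b : ZFSet.{u}), a ∈ t → b ∈ t → a.rank ≤ o → b.rank ≤ o →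
      (pair a b ∈ R ↔ code a < code b) from
    H _ a b ha hb (le_max_left _ _) (le_max_right _ _)
  intro o
  induction o using WellFoundedLT.induction with
  | ind o ih =>
  intro a b ha hb hao hbo
  rw [h a ha b hb, code_lt_code_iff (htJ ha) (htJ hb)]
  refine exists_congr fun z => and_congr_right fun hz => and_congr_right fun _ =>
    forall₂_congr fun w hw => ?_
  have hw' : w ∈ t ∧ w.rank < o := by
    rcases mem_union.1 hw with hw | hw
    · exact ⟨ht _ ha hw, (rank_lt_of_mem hw).trans_le hao⟩
    · exact ⟨ht _ hb hw, (rank_lt_of_mem hw).trans_le hbo⟩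
  rw [ih (max z.rank w.rank) (max_lt ((rank_lt_of_mem hz).trans_le hbo) hw'.2) z w
    (ht _ hb hz) hw'.1 (le_max_left _ _) (le_max_right _ _)]

theorem exists_isAckermannRel {t : ZFSet.{u}} (ht : t.IsTransitive) (htJ : t ∈ J1) :
    ∃ R ∈ J1, IsAckermannRel R t := by
  have hsub := isTransitive_J1 _ htJ
  have hmem : ∀ a ∈ t, ∀ b ∈ t,
      (pair a b ∈ (t.prod t).sep (fun p => code (fstSet p) < code (sndSet p)) ↔
        code a < code b) := by
    intro a ha b hb
    simp [ha, hb]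
  refine ⟨(t.prod t).sep fun p => code (fstSet p) < code (sndSet p), mem_J1_of_finite ?_ ?_, ?_⟩
  · exact (finite_of_mem_J1 (rudClosed_J1.prod_mem htJ htJ)).subset fun p hp => (mem_sep.1 hp).1
  · exact fun p hp => isTransitive_J1 _ (rudClosed_J1.prod_mem htJ htJ) (mem_sep.1 hp).1
  · intro a ha b hb
    rw [hmem a ha b hb, code_lt_code_iff (hsub ha) (hsub hb)]
    refine exists_congr fun z => and_congr_right fun hz => and_congr_right fun _ =>
      forall₂_congr fun w hw => ?_
    rw [hmem z (ht _ hb hz) w ((mem_union.1 hw).elim (ht _ ha ·) (ht _ hb ·))]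

/-- Ackermann's ordering of `J1` belongs to `J2`. -/
theorem exists_ackermann_order : ∃ W ∈ J2.{u}, ∀ x y : ZFSet.{u},
    pair x y ∈ W ↔ x ∈ J1 ∧ y ∈ J1 ∧ code x < code y := by
  have h : IsRudimentary 1 fun v : Fin 1 → ZFSet.{u} => ((v 0).prod (v 0)).sep fun p =>
      ∃ t ∈ v 0, ∃ R ∈ v 0, (∀ a ∈ t, ∀ b ∈ a, b ∈ t) ∧ fstSet p ∈ t ∧ sndSet p ∈ t ∧
        IsAckermannRel R t ∧ pair (fstSet p) (sndSet p) ∈ R := by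
    apply_rules [IsRudimentary.proj, IsRudimentary.sep, IsRudimentary.prod, IsRudimentary.fstSet,
      IsRudimentary.sndSet, RudRel.isAckermannRel, RudRel.exists_mem, RudRel.forall_mem,
      RudRel.and, RudRel.mem, IsRudimentary.kpair]
  refine ⟨_, rudClosed_J2 1 _ h (fun _ => J1) fun _ => J1_mem_J2, fun x y => ?_⟩
  simp only [mem_sep, pair_mem_prod, fstSet_pair, sndSet_pair]
  constructor
  · rintro ⟨⟨hx, hy⟩, t, ht, R, -, htt, hxt, hyt, hR, h⟩
    exact ⟨hx, hy, (hR.pair_mem_iff htt (isTransitive_J1 _ ht) hxt hyt).1 h⟩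
  · rintro ⟨hx, hy, h⟩
    obtain ⟨t, ht, htt, hxt, hyt⟩ := exists_isTransitive_mem_J1 hx hy
    obtain ⟨R, hRJ, hR⟩ := exists_isAckermannRel htt ht
    exact ⟨⟨hx, hy⟩, t, ht, R, hRJ, htt, hxt, hyt, hR,
      (hR.pair_mem_iff htt (isTransitive_J1 _ ht) hxt hyt).2 h⟩

/-! ### Counting and enumerating subsets of $J_1$ -/

/-- `h` restricts to a one-to-one correspondence between `x` and `y`. -/
def IsCorrespondence (h x y : ZFSet.{u}) : Prop :=
  (∀ k ∈ x, ∃ z ∈ y, pair k z ∈ h) ∧ (∀ z ∈ y, ∃ k ∈ x, pair k z ∈ h) ∧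
    ∀ k ∈ x, ∀ l ∈ x, ∀ z ∈ y, ∀ w ∈ y, pair k z ∈ h → pair l w ∈ h → (k = l ↔ z = w)

theorem RudRel.isCorrespondence {n : ℕ} {f g h : (Fin n → ZFSet.{u}) → ZFSet.{u}}
    (hf : IsRudimentary n f) (hg : IsRudimentary n g) (hh : IsRudimentary n h) :
    RudRel n fun v => IsCorrespondence (f v) (g v) (h v) := by
  suffices h : RudRel 3 fun v => IsCorrespondence (v 0) (v 1) (v 2) from
    h.comp (H := ![f, g, _]) (by intro i; fin_cases i <;> assumption)
  refine RudRel.and ?_ (RudRel.and ?_ ?_) <;>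
  apply_rules [IsRudimentary.proj, RudRel.exists_mem, RudRel.forall_mem, RudRel.and, RudRel.iff,
    RudRel.imp, RudRel.mem, RudRel.eq, IsRudimentary.kpair]

/-- The graph of a bijection between elements of $V_\omega$ is a finite subset of $V_\omega$, so
equinumerosity can be tested with a quantifier bounded by $J_1$. -/
theorem exists_isCorrespondence_iff {x y : ZFSet.{u}} (hx : x ∈ J1) (hy : y ∈ J1) :
    (∃ h ∈ J1, IsCorrespondence h x y) ↔
      (x : Set ZFSet.{u}).ncard = (y : Set ZFSet.{u}).ncard := by
  have hxf := (finite_of_mem_J1 hx).to_subtype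
  have hyf := (finite_of_mem_J1 hy).to_subtype
  constructor
  · rintro ⟨h, -, h1, h2, h3⟩
    choose! f hf hfh using h1
    refine Set.ncard_congr (fun a _ => f a) hf (fun a b ha hb hab => ?_) fun z hz => ?_
    · exact (h3 a ha b hb _ (hf a ha) _ (hf b hb) (hfh a ha) (hfh b hb)).2 hab
    · obtain ⟨k, hk, hkz⟩ := h2 z hz
      exact ⟨k, hk, (h3 k hk k hk _ (hf k hk) z hz (hfh k hk) hkz).1 rfl⟩
  · intro hc
    obtain ⟨e⟩ : Nonempty ((x : Set ZFSet.{u}) ≃ (y : Set ZFSet.{u})) :=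
      Finite.card_eq.1 hc
    have hm : ∀ k z, pair k z ∈ ZFSet.range (fun a : (x : Set ZFSet.{u}) => pair a.1 (e a).1) ↔
        ∃ hk : k ∈ x, (e ⟨k, hk⟩).1 = z := by
      intro k z
      rw [ZFSet.mem_range]
      constructor
      · rintro ⟨a, ha⟩
        obtain ⟨rfl, rfl⟩ := pair_inj.1 ha
        exact ⟨a.2, rfl⟩
      · rintro ⟨hk, rfl⟩
        exact ⟨⟨k, hk⟩, rfl⟩
    refine ⟨ZFSet.range fun a : (x : Set ZFSet.{u}) => pair a.1 (e a).1, mem_J1_of_finite ?_ ?_,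
      ?_, ?_, ?_⟩
    · rw [ZFSet.coe_range]
      exact Set.finite_range _
    · intro p hp
      obtain ⟨a, rfl⟩ := ZFSet.mem_range.1 hp
      exact rudClosed_J1.pair_mem (isTransitive_J1 _ hx a.2) (isTransitive_J1 _ hy (e a).2)
    · exact fun k hk => ⟨_, (e ⟨k, hk⟩).2, (hm _ _).2 ⟨hk, rfl⟩⟩
    · intro z hz
      exact ⟨_, (e.symm ⟨z, hz⟩).2, (hm _ _).2 ⟨(e.symm ⟨z, hz⟩).2, by simp⟩⟩
    · intro k hk l hl z hz w hw h1 h2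
      obtain ⟨_, rfl⟩ := (hm _ _).1 h1
      obtain ⟨_, rfl⟩ := (hm _ _).1 h2
      rw [Subtype.coe_inj, e.injective.eq_iff, Subtype.mk.injEq]

theorem ncard_natSet (n : ℕ) : (natSet.{u} n : Set ZFSet.{u}).ncard = n := by
  have : (natSet.{u} n : Set ZFSet.{u}) = natSet '' (Finset.range n : Set ℕ) := by
    ext x
    simp [mem_natSet, eq_comm]
  rw [this, Set.ncard_image_of_injective _ natSet_injective, Set.ncard_coe_finset,
    Finset.card_range]

/-- An infinite subset of `J1` in `J2` is enumerated by a function in `J2`. -/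
theorem exists_enumeration {A : ZFSet.{u}} (hA : A ∈ J2) (hAJ : A ⊆ J1)
    (hAi : (A : Set ZFSet.{u}).Infinite) :
    ∃ e ∈ J2, (∀ n ∈ (omega : ZFSet.{u}), ∃! a, a ∈ A ∧ pair n a ∈ e) ∧
      ∀ a ∈ A, ∃! n, n ∈ (omega : ZFSet.{u}) ∧ pair n a ∈ e := by
  obtain ⟨W, hW, hWm⟩ := exists_ackermann_order.{u}
  -- The enumeration relates $n$ to $a$ when $n$ is equinumerous with the set of predecessors of $a$
  -- in $A$.
  have h : IsRudimentary 4 fun v : Fin 4 → ZFSet.{u} => ((v 0).prod (v 1)).sep fun p =>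
      ∃ h ∈ v 2, IsCorrespondence h (fstSet p)
        (ZFSet.sep (fun y => pair y (sndSet p) ∈ v 3) (v 1)) := by
    apply_rules [IsRudimentary.proj, IsRudimentary.sep, IsRudimentary.prod, IsRudimentary.fstSet,
      IsRudimentary.sndSet, RudRel.exists_mem, RudRel.isCorrespondence, RudRel.mem,
      IsRudimentary.kpair]
  classical
  have hBJ : ∀ a ∈ A, ZFSet.sep (fun y => pair y a ∈ W) A ∈ J1 ∧
      ((ZFSet.sep (fun y => pair y a ∈ W) A : ZFSet.{u}) : Set ZFSet.{u}).ncard =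
        Nat.count (fun i => i ∈ code '' (A : Set ZFSet.{u})) (code a) := by
    intro a ha
    have hinj : Set.InjOn code
        ((ZFSet.sep (fun y => pair y a ∈ W) A : ZFSet.{u}) : Set ZFSet.{u}) :=
      code_injOn.mono fun y hy => hAJ (mem_sep.1 hy).1
    have himg : code '' ((ZFSet.sep (fun y => pair y a ∈ W) A : ZFSet.{u}) : Set ZFSet.{u}) =
        ((Finset.range (code a)).filter fun i => i ∈ code '' (A : Set ZFSet.{u}) : Finset ℕ) := by
      ext i
      simp only [Set.mem_image, SetLike.mem_coe, mem_sep, hWm, Finset.coe_filter,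
        Finset.mem_range]
      constructor
      · rintro ⟨y, ⟨hy, -, -, hlt⟩, rfl⟩
        exact ⟨hlt, y, hy, rfl⟩
      · rintro ⟨hlt, y, hy, rfl⟩
        exact ⟨y, ⟨hy, hAJ hy, hAJ ha, hlt⟩, rfl⟩
    constructor
    · refine mem_J1_of_finite (Set.Finite.of_finite_image ?_ hinj)
        fun y hy => hAJ (mem_sep.1 hy).1
      rw [himg]
      exact Finset.finite_toSet _
    · rw [← Set.InjOn.ncard_image hinj, himg, Set.ncard_coe_finset,
        Nat.count_eq_card_filter_range]
  have hinf : (code '' (A : Set ZFSet.{u})).Infinite :=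
    (Set.infinite_image_iff (code_injOn.mono hAJ)).2 hAi
  have hm : ∀ n a, (pair n a ∈ (omega.prod A).sep fun p => ∃ h ∈ J1, IsCorrespondence h (fstSet p)
      (ZFSet.sep (fun y => pair y (sndSet p) ∈ W) A)) ↔ a ∈ A ∧
        n = natSet (Nat.count (fun i => i ∈ code '' (A : Set ZFSet.{u})) (code a)) := by
    intro n a
    simp only [mem_sep, pair_mem_prod, fstSet_pair, sndSet_pair, mem_omega_iff]
    constructor
    · rintro ⟨⟨⟨m, rfl⟩, ha⟩, h⟩
      rw [exists_isCorrespondence_iff (natSet_mem_J1 m) (hBJ a ha).1, ncard_natSet,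
        (hBJ a ha).2] at h
      exact ⟨ha, by rw [h]⟩
    · rintro ⟨ha, rfl⟩
      refine ⟨⟨⟨_, rfl⟩, ha⟩, ?_⟩
      rw [exists_isCorrespondence_iff (natSet_mem_J1 _) (hBJ a ha).1, ncard_natSet, (hBJ a ha).2]
  refine ⟨_, rudClosed_J2 4 _ h ![omega, A, J1, W] ?_, fun n hn => ?_, fun a ha => ?_⟩
  · intro i
    fin_cases i
    exacts [omega_mem_J2, hA, J1_mem_J2, hW]
  · obtain ⟨n, rfl⟩ := mem_omega_iff.1 hn
    obtain ⟨a, ha, hna⟩ : ∃ a ∈ A, code a =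
        Nat.nth (fun i => i ∈ code '' (A : Set ZFSet.{u})) n := Nat.nth_mem_of_infinite hinf n
    refine ⟨a, ⟨ha, (hm _ _).2 ⟨ha, ?_⟩⟩, fun b hb => code_injOn (hAJ hb.1) (hAJ ha) ?_⟩
    · rw [hna]
      exact congrArg natSet (Nat.count_nth_of_infinite hinf n).symm
    · rw [hna, natSet_injective ((hm _ _).1 hb.2).2]
      exact (Nat.nth_count (p := fun i => i ∈ code '' (A : Set ZFSet.{u})) ⟨b, hb.1, rfl⟩).symm
  · exact ⟨_, ⟨mem_omega_iff.2 ⟨_, rfl⟩, (hm _ _).2 ⟨ha, rfl⟩⟩, fun n hn => ((hm _ _).1 hn.2).2⟩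

/-! ### $\iota$-bijections with graph in $J_2$, and the conclusion -/

theorem isIotaClass_of_mem_J2 {x : ZFSet.{u}} (hx : x ∈ J2) : IsIotaClass x := by
  refine ⟨⟨isTransitive_J2 x hx, ?_⟩, fun y hy => rudClosed_J2.inter_mem hx hy⟩
  let c : (setLang.withConstants (Set.univ : Set J2.{u})).Term (Fin 1) :=
    (setLang.con (⟨⟨x, hx⟩, trivial⟩ : (Set.univ : Set J2.{u}))).term
  let r : (setLang.withConstants (Set.univ : Set J2.{u})).Relations 2 := Sum.inl SetLangRel.mem
  refine ⟨r.formula₂ (.var 0) c, ?_⟩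
  ext v
  change (v 0).1 ∈ x ↔ (r.formula₂ (.var 0) c).Realize v
  rw [FirstOrder.Language.Formula.realize_rel₂]
  rfl

theorem isIotaFun_of_mem_J2 {X Y : ZFSet.{u}} (hX : X ∈ J2) (hY : Y ∈ J2) {F : X → Y}
    (hF : funGraph F ∈ J2) : IsIotaFun F :=
  ⟨isIotaClass_of_mem_J2 hX, isIotaClass_of_mem_J2 hY, isIotaClass_of_mem_J2 hF,
    fun _ _ _ => ⟨Y, hY, fun a _ => (F a).2⟩⟩

theorem funGraph_mem_J2_of_finite {X Y : ZFSet.{u}} (hX : X ∈ J2) (hY : Y ∈ J2)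
    (hXf : (X : Set ZFSet.{u}).Finite) (F : X → Y) : funGraph F ∈ J2 := by
  have := hXf.to_subtype
  refine rudClosed_J2.mem_of_finite empty_mem_J2
    ((Set.finite_range fun a : (X : Set ZFSet.{u}) => pair a.1 (F a).1).subset ?_) ?_
  · rintro p hp
    obtain ⟨-, a, rfl⟩ := mem_sep.1 hp
    exact ⟨a, rfl⟩
  · rintro p hp
    obtain ⟨-, a, rfl⟩ := mem_sep.1 hp
    exact rudClosed_J2.pair_mem (isTransitive_J2 _ hX a.2) (isTransitive_J2 _ hY (F a).2)

theorem exists_isIotaBijection {X Y G : ZFSet.{u}} (hX : X ∈ J2) (hY : Y ∈ J2) (hG : G ∈ J2)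
    (hXY : ∀ a ∈ X, ∃! b, b ∈ Y ∧ pair a b ∈ G) (hYX : ∀ b ∈ Y, ∃! a, a ∈ X ∧ pair a b ∈ G) :
    ∃ F : X ≃ Y, IsIotaBijection F := by
  choose f hf hf' using fun a : X => hXY a.1 a.2
  have hbij : Function.Bijective fun a : X => (⟨f a, (hf a).1⟩ : Y) := by
    constructor
    · intro a b hab
      have hab' : f a = f b := congrArg Subtype.val hab
      exact Subtype.ext ((hYX _ (hf a).1).unique ⟨a.2, (hf a).2⟩ ⟨b.2, hab' ▸ (hf b).2⟩)
    · intro b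
      obtain ⟨a, ⟨ha, hab⟩, -⟩ := hYX b.1 b.2
      exact ⟨⟨a, ha⟩, Subtype.ext (hf' ⟨a, ha⟩ b.1 ⟨b.2, hab⟩).symm⟩
  let F : X ≃ Y := Equiv.ofBijective _ hbij
  have hFG : ∀ (a : X) (b : Y), F a = b ↔ pair a.1 b.1 ∈ G := by
    intro a b
    constructor
    · rintro rfl
      exact (hf a).2
    · exact fun h => Subtype.ext (hf' a b.1 ⟨b.2, h⟩).symm
  have hinv : IsRudimentary 3 fun v : Fin 3 → ZFSet.{u} =>
      ((v 0).prod (v 1)).sep fun p => pair (sndSet p) (fstSet p) ∈ v 2 := by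
    apply_rules [IsRudimentary.proj, IsRudimentary.sep, IsRudimentary.prod, RudRel.mem,
      IsRudimentary.kpair, IsRudimentary.fstSet, IsRudimentary.sndSet]
  refine ⟨F, isIotaFun_of_mem_J2 hX hY ?_, isIotaFun_of_mem_J2 hY hX ?_⟩
  · convert rudClosed_J2.inter_mem (rudClosed_J2.prod_mem hX hY) hG
    ext p
    simp only [funGraph, mem_sep, mem_inter]
    refine and_congr_right fun hp => ?_
    obtain ⟨a, ha, b, hb, rfl⟩ := mem_prod.1 hp
    rw [← hFG ⟨a, ha⟩ ⟨b, hb⟩]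
    constructor
    · rintro ⟨c, hc⟩
      obtain ⟨rfl, rfl⟩ := pair_inj.1 hc
      rfl
    · intro h
      exact ⟨⟨a, ha⟩, by rw [h]⟩
  · convert rudClosed_J2 3 _ hinv ![Y, X, G] (by
      intro i; fin_cases i; exacts [hY, hX, hG])
    ext p
    simp only [funGraph, mem_sep]
    refine and_congr_right fun hp => ?_
    obtain ⟨b, hb, a, ha, rfl⟩ := mem_prod.1 hp
    rw [fstSet_pair, sndSet_pair]
    refine Iff.trans ?_ (hFG ⟨a, ha⟩ ⟨b, hb⟩)
    rw [← Equiv.eq_symm_apply]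
    constructor
    · rintro ⟨c, hc⟩
      obtain ⟨rfl, rfl⟩ := pair_inj.1 hc
      rfl
    · intro h
      exact ⟨⟨b, hb⟩, by rw [← h]⟩

/-- Every element of `J2` is in one-to-one correspondence, via an element of `J2`, with a
subset of `J1`. -/
theorem exists_transversal {x : ZFSet.{u}} (hx : x ∈ J2) :
    ∃ f ∈ J2, ∃ A ∈ J2, A ⊆ J1 ∧ (∀ a ∈ A, ∃! y, y ∈ x ∧ pair a y ∈ f) ∧
      ∀ y ∈ x, ∃! a, a ∈ A ∧ pair a y ∈ f := by
  obtain ⟨T, hTt, ⟨hTJ, f, hf, hfp, hfs, hff⟩, hxT⟩ := exists_covered_of_mem_J2 hx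
  obtain ⟨W, hW, hWm⟩ := exists_ackermann_order.{u}
  -- $A$ consists of those $a$ that are the $W$-least preimage of some $y\in x$.
  have h : IsRudimentary 4 fun v : Fin 4 → ZFSet.{u} => (v 0).sep fun a => ∃ y ∈ v 1,
      pair a y ∈ v 2 ∧ ∀ b ∈ v 0, pair b a ∈ v 3 → ¬ pair b y ∈ v 2 := by
    apply_rules [IsRudimentary.proj, IsRudimentary.sep, RudRel.exists_mem, RudRel.forall_mem,
      RudRel.not, RudRel.and, RudRel.imp, RudRel.mem, IsRudimentary.kpair]
  have hm : ∀ a, (a ∈ J1.sep fun a => ∃ y ∈ x,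
      pair a y ∈ f ∧ ∀ b ∈ J1, pair b a ∈ W → ¬ pair b y ∈ f) ↔ a ∈ J1 ∧ ∃ y ∈ x,
      pair a y ∈ f ∧ ∀ b ∈ J1, code b < code a → ¬ pair b y ∈ f := by
    intro a
    simp only [mem_sep, hWm]
    refine and_congr_right fun ha => exists_congr fun y => and_congr_right fun _ =>
      and_congr_right fun _ => forall₂_congr fun b hb => by simp [ha, hb]
  refine ⟨f, hf, _, rudClosed_J2 4 _ h ![J1, x, f, W] ?_, fun a ha => ((hm a).1 ha).1,
    fun a ha => ?_, fun y hy => ?_⟩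
  · intro i
    fin_cases i
    exacts [J1_mem_J2, hx, hf, hW]
  · obtain ⟨-, y, hy, hay, -⟩ := (hm a).1 ha
    exact ⟨y, ⟨hy, hay⟩, fun z hz => hff _ _ _ hz.2 hay⟩
  · obtain ⟨a, ⟨ha, hay⟩, hmin⟩ := exists_minimalFor_of_wellFoundedLT
      (fun a => a ∈ J1 ∧ pair a y ∈ f) code (hfs y (hTt x hxT hy))
    have hmin' : ∀ b ∈ J1, pair b y ∈ f → code a ≤ code b := fun b hb hby =>
      (le_total _ _).elim id (hmin ⟨hb, hby⟩)
    refine ⟨a, ⟨(hm a).2 ⟨ha, y, hy, hay, fun b hb hlt hby =>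
      absurd (hmin' b hb hby) hlt.not_ge⟩, hay⟩, ?_⟩
    rintro b ⟨hb, hby⟩
    obtain ⟨hbJ, z, hz, hbz, hb⟩ := (hm b).1 hb
    obtain rfl := hff _ _ _ hby hbz
    exact code_injOn hbJ ha
      (le_antisymm (not_lt.1 fun hlt => hb a ha hlt hay) (hmin' b hbJ hby))

theorem exists_isIotaBijection_omega {x : ZFSet.{u}} (hx : x ∈ J2)
    (hxi : (x : Set ZFSet.{u}).Infinite) :
    ∃ F : (omega : ZFSet.{u}) ≃ x, IsIotaBijection F := by
  obtain ⟨f, hf, A, hA, hAJ, hAx, hxA⟩ := exists_transversal hx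
  have hAi : (A : Set ZFSet.{u}).Infinite := by
    intro hAf
    choose! g hg hg' using hAx
    refine hxi ((hAf.image g).subset fun y hy => ?_)
    obtain ⟨a, ⟨ha, hay⟩, -⟩ := hxA y hy
    exact ⟨a, ha, (hg' a ha y ⟨hy, hay⟩).symm⟩
  obtain ⟨e, he, hωA, hAω⟩ := exists_enumeration hA hAJ hAi
  have h : IsRudimentary 5 fun v : Fin 5 → ZFSet.{u} => ((v 0).prod (v 1)).sep fun p =>
      ∃ a ∈ v 2, pair (fstSet p) a ∈ v 3 ∧ pair a (sndSet p) ∈ v 4 := by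
    apply_rules [IsRudimentary.proj, IsRudimentary.sep, IsRudimentary.prod, RudRel.exists_mem,
      RudRel.and, RudRel.mem, IsRudimentary.kpair, IsRudimentary.fstSet, IsRudimentary.sndSet]
  have hm : ∀ n y, (pair n y ∈ (omega.prod x).sep fun p =>
      ∃ a ∈ A, pair (fstSet p) a ∈ e ∧ pair a (sndSet p) ∈ f) ↔ (n ∈ (omega : ZFSet.{u}) ∧ y ∈ x) ∧
        ∃ a ∈ A, pair n a ∈ e ∧ pair a y ∈ f := by
    intro n y
    simp only [mem_sep, pair_mem_prod, fstSet_pair, sndSet_pair]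
  refine exists_isIotaBijection omega_mem_J2 hx
    (rudClosed_J2 5 _ h ![omega, x, A, e, f] ?_) (fun n hn => ?_) (fun y hy => ?_)
  · intro i
    fin_cases i
    exacts [omega_mem_J2, hx, hA, he, hf]
  · obtain ⟨a, ⟨ha, hna⟩, ha'⟩ := hωA n hn
    obtain ⟨y, ⟨hy, hay⟩, hy'⟩ := hAx a ha
    refine ⟨y, ⟨hy, (hm n y).2 ⟨⟨hn, hy⟩, a, ha, hna, hay⟩⟩, fun z hz => ?_⟩
    obtain ⟨-, b, hb, hnb, hbz⟩ := (hm n z).1 hz.2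
    obtain rfl := ha' b ⟨hb, hnb⟩
    exact hy' z ⟨hz.1, hbz⟩
  · obtain ⟨a, ⟨ha, hay⟩, ha'⟩ := hxA y hy
    obtain ⟨n, ⟨hn, hna⟩, hn'⟩ := hAω a ha
    refine ⟨n, ⟨hn, (hm n y).2 ⟨⟨hn, hy⟩, a, ha, hna, hay⟩⟩, fun k hk => ?_⟩
    obtain ⟨-, b, hb, hkb, hby⟩ := (hm k y).1 hk.2
    obtain rfl := ha' b ⟨hb, hby⟩
    exact hn' k ⟨hk.1, hkb⟩

theorem theorem2p10 (x : ZFSet.{u}) (hx : IsIotaSet x) :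
    ((x : Set ZFSet.{u}).Infinite →
      ∃ F : (ZFSet.omega : ZFSet.{u}) ≃ x, IsIotaBijection F) ∧
    ((x : Set ZFSet.{u}).Finite →
      ∃ n ∈ (ZFSet.omega : ZFSet.{u}), ∃ F : n ≃ x, IsIotaBijection F) := by
  refine ⟨exists_isIotaBijection_omega hx, fun hxf => ?_⟩
  have hn := J1_subset_J2 (natSet_mem_J1.{u} (x : Set ZFSet.{u}).ncard)
  have hnf := finite_of_mem_J1 (natSet_mem_J1.{u} (x : Set ZFSet.{u}).ncard)
  refine ⟨_, mem_omega_iff.2 ⟨(x : Set ZFSet.{u}).ncard, rfl⟩, ?_⟩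
  have := hxf.to_subtype
  have := hnf.to_subtype
  obtain ⟨F⟩ : Nonempty ((natSet.{u} (x : Set ZFSet.{u}).ncard : Set ZFSet.{u}) ≃
      (x : Set ZFSet.{u})) := Finite.card_eq.1 (ncard_natSet _)
  exact ⟨F, isIotaFun_of_mem_J2 hn hx (funGraph_mem_J2_of_finite hn hx hnf _),
    isIotaFun_of_mem_J2 hx hn (funGraph_mem_J2_of_finite hx hn hxf _)⟩
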